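/- Let $X,Y$ be Polish spaces, let $\mu$ and $\nu$ be Borel probability measures on $X$ and $Y$, and let $c:X\times Y\to[0,\infty]$ be a lower semi-continuous cost function with $c<\infty$ $\mu\otimes\nu$-almost surely. Let $\Pi(\mu,\nu)$ be the set of transport plans, i.e. of Borel probability measures on $X\times Y$ with first marginal $\mu$ and second marginal $\nu$, and put $I(\pi)=\int_{X\times Y}c\,d\pi$ for $\pi\in\Pi(\mu,\nu)$. Let $\widehat\pi\in\Pi(\mu,\nu)$ be an optimizer, i.e. $I(\widehat\pi)\le I(\pi)$ for all $\pi\in\Pi(\mu,\nu)$, and assume that $I(\widehat\pi)<\infty$. Then there exist Borel functions $\phi:X\to\mathbb{R}\cup\{-\infty\}$ and $\psi:Y\to\mathbb{R}\cup\{-\infty\}$ such that $$\phi(x)+\psi(y)\le c(x,y)\qquad\text{for all }x\in X,\ y\in Y,$$ and $\phi(x)+\psi(y)=c(x,y)$ for $\widehat\pi$-almost all $(x,y)$. In particular, $\widehat\pi$ is strongly $c$-monotone: there is a Borel set $\Gamma\subset X\times Y$ with $\widehat\pi(\Gamma)=1$ for which there exist Borel functions $\phi:X\to\mathbb{R}\cup\{-\infty\}$,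 $\psi:Y\to\mathbb{R}\cup\{-\infty\}$ with $\phi(x)+\psi(y)\le c(x,y)$ for all $(x,y)\in X\times Y$ and equality for all $(x,y)\in\Gamma$. -/

import Mathlib

open MeasureTheory
open scoped ENNReal

/-- The set `Π(μ, ν)` of transport plans: the Borel probability measures on `X × Y` with first
marginal `μ` and second marginal `ν`. -/
def transportPlans {X Y : Type*} [MeasurableSpace X] [MeasurableSpace Y]
    (μ : Measure X) (ν : Measure Y) : Set (Measure (X × Y)) :=
  {π | IsProbabilityMeasure π ∧ π.map Prod.fst = μ ∧ π.map Prod.snd = ν}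

/-- The cost `I(π) = ∫ c dπ` of a measure on the product; `c` takes values in `[0, ∞]`. -/
noncomputable def transportCost {X Y : Type*} [MeasurableSpace X] [MeasurableSpace Y]
    (c : X × Y → ℝ≥0∞) (π : Measure (X × Y)) : ℝ≥0∞ :=
  ∫⁻ z, c z ∂π

/-- `π` is an optimizer of the Monge-Kantorovich problem for `(μ, ν, c)`: it is a transport plan
that minimizes the cost among all transport plans. -/
def IsOptimizer {X Y : Type*} [MeasurableSpace X] [MeasurableSpace Y]
    (μ : Measure X) (ν : Measure Y) (c : X × Y → ℝ≥0∞) (π : Measure (X × Y)) : Prop :=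
  π ∈ transportPlans μ ν ∧ ∀ π' ∈ transportPlans μ ν, transportCost c π ≤ transportCost c π'

/-- A Borel set `Γ` is strongly `c`-monotone if there are Borel functions `φ`, `ψ` with values in
`ℝ ∪ {-∞}` (extended reals different from `+∞`) such that `φ(x) + ψ(y) ≤ c(x, y)` for all `(x, y)`,
with equality on `Γ`. -/
def IsStronglyMonotoneSet {X Y : Type*} [MeasurableSpace X] [MeasurableSpace Y]
    (c : X × Y → ℝ≥0∞) (Γ : Set (X × Y)) : Prop :=
  MeasurableSet Γ ∧ ∃ (φ : X → EReal) (ψ : Y → EReal),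
    Measurable φ ∧ Measurable ψ ∧ (∀ x, φ x ≠ ⊤) ∧ (∀ y, ψ y ≠ ⊤) ∧
    (∀ x y, φ x + ψ y ≤ (c (x, y) : EReal)) ∧
    ∀ x y, (x, y) ∈ Γ → φ x + ψ y = (c (x, y) : EReal)

/-- A transport plan `π` is strongly `c`-monotone if it is concentrated on a strongly `c`-monotone
Borel set. -/
def IsStronglyMonotonePlan {X Y : Type*} [MeasurableSpace X] [MeasurableSpace Y]
    (c : X × Y → ℝ≥0∞) (π : Measure (X × Y)) : Prop :=
  ∃ Γ : Set (X × Y), IsStronglyMonotoneSet c Γ ∧ π Γ = 1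

/-!
Two ingredients give the potentials: Kantorovich duality, and a limit argument that turns a
maximizing sequence of the dual problem into a maximizer.

*Duality.* Suppose `∫ φ dμ + ∫ ψ dν ≤ d` for all bounded continuous `φ ⊕ ψ ≤ c`. Embed `X` and `Y`
in the Hilbert cube `Q`. The M. Riesz extension theorem yields a positive linear functional `Λ` on
`C(Q × Q)` which is `∫ φ dμ + ∫ ψ dν` on functions restricting to `φ ⊕ ψ` on `X × Y` and is at most
`d` on functions lying below `c` there (`exists_linearMap_of_potentials_le`). It is integration
against a measure, whose marginals are the images of `μ` and `ν`; as these are carried by the Borel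
copies of `X` and `Y`, the measure is a transport plan on `X × Y` (`exists_comap_measure`). Since `c`
is an increasing limit of continuous functions on `Q × Q`, the cost of this plan is at most `d`
(`exists_transportPlan_cost_le`). Working in the Hilbert cube replaces any tightness argument.

*Limits.* For an optimizer `π` there are therefore `φₙ ⊕ ψₙ ≤ c` with `φₙ ⊕ ψₙ → c` `π`-almost
everywhere (`IsOptimizer.exists_potentials_tendsto`). Choose a point `(x₀, y₀)` at which convergence
holds and with `c(x₀, ·)` and `c(·, y₀)` almost everywhere finite, and normalize `φₙ(x₀) = 0`. Then
`φ = limsup φₙ` and `ψ = liminf ψₙ` satisfy `φ ⊕ ψ ≤ c`. Putting `x = x₀` or `y = y₀` in this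
inequality shows that `φ` and `ψ` are less than `+∞` almost everywhere, and at points of convergence
where this holds, `c = liminf (φₙ ⊕ ψₙ) ≤ limsup φₙ + liminf ψₙ = φ ⊕ ψ`
(`exists_potentials_of_tendsto`).
-/

open Filter Topology Set
open scoped BoundedContinuousFunction

/-! ### Approximation of lower semicontinuous functions -/

/-- A lower semicontinuous function on a space embedded in a metrizable space `K` is the increasing
limit of finite continuous functions defined on all of `K`: take the truncated infimal convolutions
`k ↦ min n (⨅ z, c z + n * d(k, e z))`. -/
lemma LowerSemicontinuous.exists_seq_continuous_iSup_eq {Z K : Type*} [TopologicalSpace Z]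
    [TopologicalSpace K] [TopologicalSpace.MetrizableSpace K] {e : Z → K} (he : IsInducing e)
    {c : Z → ℝ≥0∞} (hc : LowerSemicontinuous c) :
    ∃ g : ℕ → K → ℝ≥0∞, (∀ n, Continuous (g n)) ∧ (∀ n k, g n k ≠ ∞) ∧ Monotone g ∧
      (∀ n z, g n (e z) ≤ c z) ∧ ∀ z, ⨆ n, g n (e z) = c z := by
  let _ := TopologicalSpace.metrizableSpaceMetric K
  let g : ℕ → K → ℝ≥0∞ := fun n k ↦ min (n : ℝ≥0∞) (⨅ z, (c z + n * edist k (e z)))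
  have hle : ∀ n z, g n (e z) ≤ c z := fun n z ↦
    (min_le_right _ _).trans ((iInf_le _ z).trans (by simp))
  refine ⟨g, fun n ↦ ?_, fun n k ↦ ?_, ?_, hle, fun z ↦ ?_⟩
  · refine continuous_of_le_add_edist (n : ℝ≥0∞) (by simp) fun x y ↦ ?_
    simp only [g]
    rw [min_add]
    refine min_le_min le_self_add ?_
    rw [ENNReal.iInf_add]
    refine iInf_mono fun z ↦ ?_
    calc c z + n * edist x (e z) ≤ c z + n * (edist x y + edist y (e z)) := by
          gcongr; exact edist_triangle _ _ _
      _ = c z + n * edist y (e z) + n * edist x y := by ring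
  · exact ((min_le_left _ _).trans_lt (ENNReal.natCast_lt_top n)).ne
  · intro m n hmn k
    have : (m : ℝ≥0∞) ≤ n := by exact_mod_cast hmn
    refine min_le_min this (iInf_mono fun z ↦ ?_)
    gcongr
  · refine le_antisymm (iSup_le fun n ↦ hle n z) (le_of_forall_lt fun a ha ↦ ?_)
    obtain ⟨b, hab, hb⟩ := exists_between ha
    obtain ⟨ε, hε, hball⟩ := Metric.nhds_basis_eball.mem_iff.1
      (show {k | ∀ w, e w = k → b < c w} ∈ 𝓝 (e z) from by
        have := hc z b hb
        rw [he.nhds_eq_comap, eventually_comap] at this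
        exact this)
    have hlow : ∀ n : ℕ, min (n : ℝ≥0∞) (min b (n * ε)) ≤ g n (e z) := fun n ↦ by
      refine min_le_min le_rfl (le_iInf fun w ↦ ?_)
      by_cases hw : e w ∈ Metric.eball (e z) ε
      · exact (min_le_left _ _).trans ((hball hw w rfl).le.trans le_self_add)
      · refine (min_le_right _ _).trans (le_trans ?_ le_add_self)
        rw [Metric.mem_eball, not_lt, edist_comm] at hw
        gcongr
    have hbtop : b ≠ ∞ := hb.ne_top
    obtain ⟨n₁, hn₁⟩ := ENNReal.exists_nat_gt hbtop
    obtain ⟨n₂, hn₂⟩ := ENNReal.exists_nat_mul_gt hε.ne' hbtop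
    refine hab.trans_le (le_trans ?_ (le_iSup (fun n ↦ g n (e z)) (max n₁ n₂)))
    refine le_trans ?_ (hlow _)
    refine le_min (hn₁.le.trans (by gcongr; exact le_max_left _ _))
      (le_min le_rfl (hn₂.le.trans ?_))
    gcongr
    exact le_max_right _ _

/-! ### Kantorovich duality -/

/-- The Riesz-Markov-Kakutani theorem for positive functionals on `C(K, ℝ)`, `K` compact. -/
lemma exists_measure_integral_eq {K : Type*} [TopologicalSpace K] [CompactSpace K] [T2Space K]
    [MeasurableSpace K] [BorelSpace K] (Λ : C(K, ℝ) →ₗ[ℝ] ℝ) (hΛ : ∀ f, 0 ≤ f → 0 ≤ Λ f) :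
    ∃ ρ : Measure K, IsFiniteMeasure ρ ∧ ∀ f : C(K, ℝ), ∫ z, f z ∂ρ = Λ f := by
  let Λ' : CompactlySupportedContinuousMap K ℝ →ₚ[ℝ] ℝ := PositiveLinearMap.mk₀
    { toFun := fun f ↦ Λ f.toContinuousMap
      map_add' := fun f g ↦ Λ.map_add f.toContinuousMap g.toContinuousMap
      map_smul' := fun r f ↦ Λ.map_smul r f.toContinuousMap }
    fun f hf ↦ hΛ _ hf
  exact ⟨RealRMK.rieszMeasure Λ', inferInstance, fun f ↦
    RealRMK.integral_rieszMeasure Λ' (CompactlySupportedContinuousMap.continuousMapEquiv f)⟩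

/-- A measure on `A × B` whose marginals are carried by embedded copies of `(X, μ)` and `(Y, ν)` is
itself carried by the embedded copy of `X × Y`, so it comes from a transport plan. -/
lemma exists_comap_measure {X Y A B : Type*} [MeasurableSpace X] [MeasurableSpace Y]
    [MeasurableSpace A] [MeasurableSpace B] {μ : Measure X} {ν : Measure Y} {e : X → A} {e' : Y → B}
    [IsProbabilityMeasure μ]
    (he : MeasurableEmbedding e) (he' : MeasurableEmbedding e') {ρ : Measure (A × B)}
    (h1 : ρ.map Prod.fst = μ.map e) (h2 : ρ.map Prod.snd = ν.map e') :
    ∃ π ∈ transportPlans μ ν, π.map (Prod.map e e') = ρ := by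
  have hE := he.prodMap he'
  have hmap : (ρ.comap (Prod.map e e')).map (Prod.map e e') = ρ := by
    rw [hE.map_comap, Measure.restrict_eq_self_of_ae_mem]
    have ha : ∀ᵐ z ∂ρ, z.1 ∈ range e := ae_of_ae_map measurable_fst.aemeasurable (by
      rw [h1]; exact ae_map_mem_range e he.measurableSet_range μ)
    have hb : ∀ᵐ z ∂ρ, z.2 ∈ range e' := ae_of_ae_map measurable_snd.aemeasurable (by
      rw [h2]; exact ae_map_mem_range e' he'.measurableSet_range ν)
    filter_upwards [ha, hb] with z hz hz'
    rw [range_prodMap]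
    exact ⟨hz, hz'⟩
  have hfst : (ρ.comap (Prod.map e e')).map Prod.fst = μ := by
    rw [← he.comap_map μ, ← h1, ← he.comap_map (Measure.map Prod.fst _),
      Measure.map_map he.measurable measurable_fst]
    nth_rewrite 2 [← hmap]
    rw [Measure.map_map measurable_fst hE.measurable]
    rfl
  have hsnd : (ρ.comap (Prod.map e e')).map Prod.snd = ν := by
    rw [← he'.comap_map ν, ← h2, ← he'.comap_map (Measure.map Prod.snd _),
      Measure.map_map he'.measurable measurable_snd]
    nth_rewrite 2 [← hmap]
    rw [Measure.map_map measurable_snd hE.measurable]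
    rfl
  refine ⟨_, ⟨⟨?_⟩, hfst, hsnd⟩, hmap⟩
  rw [← preimage_univ (f := Prod.fst), ← Measure.map_apply measurable_fst .univ, hfst, measure_univ]

/-- The Hahn-Banach step of the duality: if `d` bounds the dual problem for the cost `c`, then
`(φ, ψ, t) ↦ ∫ φ dμ + ∫ ψ dν + t d` is nonnegative whenever `φ ⊕ ψ + t c ≥ 0` and `t ≥ 0`, and it
extends to `C(K, ℝ) × C_b(X) × C_b(Y) × ℝ` with the same positivity for `f ∘ j + φ ⊕ ψ + t c ≥ 0`.
Here `Λ` is the restriction of the extension to `C(K, ℝ)`. The inequality is written with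
`ENNReal.ofReal` of the negative of `f ∘ j + φ ⊕ ψ` on the left because `c` may be infinite;
`0 * ⊤ = 0` makes it the right condition at `t = 0`. -/
lemma exists_linearMap_of_potentials_le {X Y K : Type*}
    [TopologicalSpace X] [MeasurableSpace X] [OpensMeasurableSpace X]
    [TopologicalSpace Y] [MeasurableSpace Y] [OpensMeasurableSpace Y]
    [TopologicalSpace K] [CompactSpace K]
    (μ : Measure X) [IsFiniteMeasure μ] (ν : Measure Y) [IsFiniteMeasure ν]
    {c : X × Y → ℝ≥0∞} {d : ℝ} (j : X × Y → K)
    (hd : ∀ (φ : X →ᵇ ℝ) (ψ : Y →ᵇ ℝ), (∀ x y, ENNReal.ofReal (φ x + ψ y) ≤ c (x, y)) →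
      ∫ x, φ x ∂μ + ∫ y, ψ y ∂ν ≤ d) :
    ∃ Λ : C(K, ℝ) →ₗ[ℝ] ℝ, ∀ (f : C(K, ℝ)) (φ : X →ᵇ ℝ) (ψ : Y →ᵇ ℝ) (t : ℝ), 0 ≤ t →
      (∀ x y, ENNReal.ofReal (-(f (j (x, y)) + φ x + ψ y)) ≤ ENNReal.ofReal t * c (x, y)) →
      0 ≤ Λ f + (∫ x, φ x ∂μ + ∫ y, ψ y ∂ν + t * d) := by
  let F : C(K, ℝ) × (X →ᵇ ℝ) × (Y →ᵇ ℝ) × ℝ →ₗ[ℝ] ℝ :=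
    { toFun := fun u ↦ ∫ x, u.2.1 x ∂μ + ∫ y, u.2.2.1 y ∂ν + u.2.2.2 * d
      map_add' := fun u v ↦ by
        simp only [Prod.snd_add, Prod.fst_add, BoundedContinuousFunction.coe_add, Pi.add_apply]
        rw [integral_add (u.2.1.integrable μ) (v.2.1.integrable μ),
          integral_add (u.2.2.1.integrable ν) (v.2.2.1.integrable ν)]
        ring
      map_smul' := fun r u ↦ by
        simp only [Prod.smul_snd, Prod.smul_fst, BoundedContinuousFunction.coe_smul,
          smul_eq_mul, integral_const_mul, RingHom.id_apply]
        ring }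
  let S : PointedCone ℝ (C(K, ℝ) × (X →ᵇ ℝ) × (Y →ᵇ ℝ) × ℝ) :=
    { carrier := {u | 0 ≤ u.2.2.2 ∧ ∀ x y,
        ENNReal.ofReal (-(u.1 (j (x, y)) + u.2.1 x + u.2.2.1 y)) ≤
          ENNReal.ofReal u.2.2.2 * c (x, y)}
      add_mem' := fun {u v} hu hv ↦ by
        refine ⟨add_nonneg hu.1 hv.1, fun x y ↦ ?_⟩
        simp only [Prod.snd_add, Prod.fst_add, BoundedContinuousFunction.coe_add, Pi.add_apply,
          ContinuousMap.add_apply]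
        rw [ENNReal.ofReal_add hu.1 hv.1, add_mul]
        refine le_trans (le_of_eq_of_le ?_ ENNReal.ofReal_add_le) (add_le_add (hu.2 x y) (hv.2 x y))
        congr 1
        ring
      zero_mem' := by simp
      smul_mem' := fun r u hu ↦ by
        refine ⟨mul_nonneg r.2 hu.1, fun x y ↦ ?_⟩
        have hr : (r : ℝ) * -(u.1 (j (x, y)) + u.2.1 x + u.2.2.1 y)
          = -((r • u).1 (j (x, y)) + (r • u).2.1 x + (r • u).2.2.1 y) := by
          change _ = -((r : ℝ) * u.1 (j (x, y)) + (r : ℝ) * u.2.1 x + (r : ℝ) * u.2.2.1 y)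
          ring
        have hr' : (r • u).2.2.2 = (r : ℝ) * u.2.2.2 := rfl
        rw [← hr, hr', ENNReal.ofReal_mul r.2, ENNReal.ofReal_mul r.2, mul_assoc]
        gcongr
        exact hu.2 x y }
  obtain ⟨G, hG, hGS⟩ := riesz_extension S
    (F.toPMap (LinearMap.ker (LinearMap.fst ℝ C(K, ℝ) ((X →ᵇ ℝ) × (Y →ᵇ ℝ) × ℝ)))) (by
      rintro ⟨⟨f, φ, ψ, t⟩, hf⟩ ⟨ht, hS⟩
      obtain rfl : f = 0 := hf
      change 0 ≤ ∫ x, φ x ∂μ + ∫ y, ψ y ∂ν + t * d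
      -- The case `t = 0` does not allow division by `t`, so it is reached as a limit from above.
      have key : ∀ s > t, 0 ≤ ∫ x, φ x ∂μ + ∫ y, ψ y ∂ν + s * d := fun s hs ↦ by
        have hs0 : 0 < s := lt_of_le_of_lt ht hs
        have := hd (-s⁻¹ • φ) (-s⁻¹ • ψ) fun x y ↦ by
          have h1 : ENNReal.ofReal (-(φ x + ψ y)) ≤ ENNReal.ofReal s * c (x, y) := by
            have h2 := hS x y
            simp only [ContinuousMap.zero_apply, zero_add] at h2
            exact h2.trans (by gcongr)
          have h3 : (-s⁻¹ • φ) x + (-s⁻¹ • ψ) y = s⁻¹ * -(φ x + ψ y) := by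
            simp; ring
          rw [h3, ENNReal.ofReal_mul (by positivity)]
          refine (mul_le_mul_right h1 _).trans_eq ?_
          rw [← mul_assoc, ← ENNReal.ofReal_mul (by positivity), inv_mul_cancel₀ hs0.ne']
          simp
        simp only [BoundedContinuousFunction.coe_smul, smul_eq_mul, integral_const_mul] at this
        have h4 := mul_le_mul_of_nonneg_left this hs0.le
        have h5 : s * (-s⁻¹ * ∫ x, φ x ∂μ + -s⁻¹ * ∫ y, ψ y ∂ν) =
          -(∫ x, φ x ∂μ + ∫ y, ψ y ∂ν) := by field_simp; ring
        linarith
      have hlim : Tendsto (fun s ↦ ∫ x, φ x ∂μ + ∫ y, ψ y ∂ν + s * d) (𝓝[>] t)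
          (𝓝 (∫ x, φ x ∂μ + ∫ y, ψ y ∂ν + t * d)) :=
        (Continuous.tendsto (by fun_prop) t).mono_left nhdsWithin_le_nhds
      exact ge_of_tendsto hlim (eventually_nhdsWithin_of_forall key)) (by
      rintro ⟨f, φ, ψ, t⟩
      refine ⟨⟨(0, .const X (‖f‖ + ‖φ‖ + ‖ψ‖), 0, -t), rfl⟩, (by simp), fun x y ↦ ?_⟩
      have h1 := (abs_le.1 (f.norm_coe_le_norm (j (x, y)))).1
      have h2 := (abs_le.1 (φ.norm_coe_le_norm x)).1
      have h3 := (abs_le.1 (ψ.norm_coe_le_norm y)).1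
      rw [ENNReal.ofReal_of_nonpos]
      · exact zero_le
      · simp
        linarith)
  refine ⟨G.comp (LinearMap.inl ℝ _ _), fun f φ ψ t ht h ↦ ?_⟩
  have h1 : G (0, φ, ψ, t) = ∫ x, φ x ∂μ + ∫ y, ψ y ∂ν + t * d := hG ⟨(0, φ, ψ, t), rfl⟩
  rw [← h1, LinearMap.comp_apply, LinearMap.inl_apply, ← map_add, Prod.mk_add_mk, add_zero,
    zero_add]
  exact hGS _ ⟨ht, h⟩

/-- Kantorovich duality for lower semicontinuous costs on Polish spaces, in the direction that
produces a plan: if `d` bounds all values of the dual problem, some plan has cost at most `d`. -/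
theorem exists_transportPlan_cost_le {X Y : Type*}
    [TopologicalSpace X] [PolishSpace X] [MeasurableSpace X] [BorelSpace X]
    [TopologicalSpace Y] [PolishSpace Y] [MeasurableSpace Y] [BorelSpace Y]
    (μ : Measure X) [IsProbabilityMeasure μ] (ν : Measure Y) [IsProbabilityMeasure ν]
    {c : X × Y → ℝ≥0∞} (hc : LowerSemicontinuous c) {d : ℝ}
    (hd : ∀ (φ : X →ᵇ ℝ) (ψ : Y →ᵇ ℝ), (∀ x y, ENNReal.ofReal (φ x + ψ y) ≤ c (x, y)) →
      ∫ x, φ x ∂μ + ∫ y, ψ y ∂ν ≤ d) :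
    ∃ π ∈ transportPlans μ ν, transportCost c π ≤ ENNReal.ofReal d := by
  let _ := TopologicalSpace.metrizableSpaceMetric X
  let _ := TopologicalSpace.metrizableSpaceMetric Y
  obtain ⟨e, he⟩ := Metric.PiNatEmbed.exists_embedding_to_hilbert_cube (X := X)
  obtain ⟨e', he'⟩ := Metric.PiNatEmbed.exists_embedding_to_hilbert_cube (X := Y)
  have hme : MeasurableEmbedding e := he.continuous.measurableEmbedding he.injective
  have hme' : MeasurableEmbedding e' := he'.continuous.measurableEmbedding he'.injective
  obtain ⟨Λ, hΛ⟩ := exists_linearMap_of_potentials_le μ ν (Prod.map e e') hd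
  obtain ⟨ρ, hρ, hρΛ⟩ := exists_measure_integral_eq Λ fun f hf ↦ by
    have h := hΛ f 0 0 0 le_rfl fun x y ↦ by
      have : 0 ≤ f (e x, e' y) := hf _
      rw [ENNReal.ofReal_of_nonpos]
      · exact zero_le
      · simpa using this
    simpa using h
  -- Testing with `± f` fixes the integrals of the functions that split as `φ ⊕ ψ`,
  -- hence the marginals of `ρ`.
  have hmarg : ∀ (f : C((ℕ → unitInterval) × (ℕ → unitInterval), ℝ)) (φ : X →ᵇ ℝ) (ψ : Y →ᵇ ℝ),
      (∀ x y, f (e x, e' y) = φ x + ψ y) → ∫ z, f z ∂ρ = ∫ x, φ x ∂μ + ∫ y, ψ y ∂ν := by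
    intro f φ ψ h
    have h1 := hΛ f (-φ) (-ψ) 0 le_rfl fun x y ↦ by simp [h]
    have h2 := hΛ (-f) φ ψ 0 le_rfl fun x y ↦ by simp [h, add_assoc]
    rw [hρΛ]
    simp only [BoundedContinuousFunction.coe_neg, Pi.neg_apply, integral_neg, map_neg] at h1 h2
    linarith
  have hfst : ρ.map Prod.fst = μ.map e := by
    have := Measure.isFiniteMeasure_map μ e
    refine ext_of_forall_integral_eq_of_IsFiniteMeasure fun g ↦ ?_
    rw [integral_map measurable_fst.aemeasurable g.continuous.aestronglyMeasurable,
      integral_map hme.measurable.aemeasurable g.continuous.aestronglyMeasurable]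
    have := hmarg ⟨fun z ↦ g z.1, by fun_prop⟩ (g.compContinuous ⟨e, he.continuous⟩) 0
      (by simp)
    simpa using this
  have hsnd : ρ.map Prod.snd = ν.map e' := by
    have := Measure.isFiniteMeasure_map ν e'
    refine ext_of_forall_integral_eq_of_IsFiniteMeasure fun g ↦ ?_
    rw [integral_map measurable_snd.aemeasurable g.continuous.aestronglyMeasurable,
      integral_map hme'.measurable.aemeasurable g.continuous.aestronglyMeasurable]
    have := hmarg ⟨fun z ↦ g z.2, by fun_prop⟩ 0 (g.compContinuous ⟨e', he'.continuous⟩)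
      (by simp)
    simpa using this
  obtain ⟨π, hπ, hπρ⟩ := exists_comap_measure hme hme' hfst hsnd
  refine ⟨π, hπ, ?_⟩
  obtain ⟨g, hgc, hgt, hgm, hgle, hgs⟩ :=
    hc.exists_seq_continuous_iSup_eq (he.prodMap he').isInducing
  calc transportCost c π = ∫⁻ z, ⨆ n, g n (Prod.map e e' z) ∂π := by simp [transportCost, hgs]
    _ = ⨆ n, ∫⁻ z, g n (Prod.map e e' z) ∂π :=
      lintegral_iSup (fun n ↦ (hgc n).measurable.comp (hme.prodMap hme').measurable)
        fun m n hmn z ↦ hgm hmn _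
    _ ≤ ENNReal.ofReal d := iSup_le fun n ↦ ?_
  have hgc' : Continuous fun z ↦ (g n z).toReal :=
    ENNReal.continuousOn_toReal.comp_continuous (hgc n) (hgt n)
  -- Testing with `t = 1` bounds `Λ` by `d` on the continuous functions below the cost.
  have hle := hΛ (-⟨_, hgc'⟩) 0 0 1 zero_le_one fun x y ↦ by
    simpa [ENNReal.ofReal_toReal (hgt _ _)] using hgle n (x, y)
  rw [map_neg, ← hρΛ] at hle
  rw [← lintegral_map (hgc n).measurable (hme.prodMap hme').measurable, hπρ]
  have hint : Integrable (fun z ↦ (g n z).toReal) ρ :=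
    (BoundedContinuousFunction.mkOfCompact ⟨_, hgc'⟩).integrable ρ
  have : ∫⁻ z, g n z ∂ρ = ENNReal.ofReal (∫ z, (g n z).toReal ∂ρ) := by
    rw [ofReal_integral_eq_lintegral_ofReal hint (ae_of_all _ fun _ ↦ ENNReal.toReal_nonneg)]
    simp [ENNReal.ofReal_toReal (hgt _ _)]
  rw [this]
  refine ENNReal.ofReal_le_ofReal ?_
  simp at hle
  linarith

/-! ### Maximizing sequences of the dual problem -/

lemma transportPlans.integral_add_eq {X Y : Type*}
    [TopologicalSpace X] [MeasurableSpace X] [OpensMeasurableSpace X]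
    [TopologicalSpace Y] [MeasurableSpace Y] [OpensMeasurableSpace Y]
    {μ : Measure X} {ν : Measure Y} {π : Measure (X × Y)}
    (hπ : π ∈ transportPlans μ ν) (φ : X →ᵇ ℝ) (ψ : Y →ᵇ ℝ) :
    Integrable (fun z ↦ φ z.1 + ψ z.2) π ∧
      ∫ z, (φ z.1 + ψ z.2) ∂π = ∫ x, φ x ∂μ + ∫ y, ψ y ∂ν := by
  obtain ⟨hprob, rfl, rfl⟩ := hπ
  have := Measure.isFiniteMeasure_map π Prod.fst
  have := Measure.isFiniteMeasure_map π Prod.snd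
  have hφ : Integrable (fun z ↦ φ z.1) π :=
    (φ.integrable (π.map Prod.fst)).comp_measurable measurable_fst
  have hψ : Integrable (fun z ↦ ψ z.2) π :=
    (ψ.integrable (π.map Prod.snd)).comp_measurable measurable_snd
  have hφm : AEStronglyMeasurable φ (π.map Prod.fst) := (φ.integrable _).aestronglyMeasurable
  have hψm : AEStronglyMeasurable ψ (π.map Prod.snd) := (ψ.integrable _).aestronglyMeasurable
  refine ⟨hφ.add hψ, ?_⟩
  rw [integral_add hφ hψ, integral_map measurable_fst.aemeasurable hφm,
    integral_map measurable_snd.aemeasurable hψm]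

lemma IsOptimizer.exists_potentials_lt {X Y : Type*}
    [TopologicalSpace X] [PolishSpace X] [MeasurableSpace X] [BorelSpace X]
    [TopologicalSpace Y] [PolishSpace Y] [MeasurableSpace Y] [BorelSpace Y]
    {μ : Measure X} [IsProbabilityMeasure μ] {ν : Measure Y} [IsProbabilityMeasure ν]
    {c : X × Y → ℝ≥0∞} (hc : LowerSemicontinuous c) {π : Measure (X × Y)}
    (hopt : IsOptimizer μ ν c π) {ε : ℝ} (hε : 0 < ε) :
    ∃ (φ : X →ᵇ ℝ) (ψ : Y →ᵇ ℝ), (∀ x y, ENNReal.ofReal (φ x + ψ y) ≤ c (x, y)) ∧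
      (transportCost c π).toReal - ε < ∫ x, φ x ∂μ + ∫ y, ψ y ∂ν := by
  by_contra! h
  have h0 := h 0 0 (by simp)
  obtain ⟨π', hπ', hle⟩ := exists_transportPlan_cost_le μ ν hc h
  have h1 := ENNReal.toReal_mono ENNReal.ofReal_ne_top ((hopt.2 π' hπ').trans hle)
  rw [ENNReal.toReal_ofReal (by simpa using h0)] at h1
  linarith

/-- Along a fast maximizing sequence of the dual problem the gaps `c - φₙ ⊕ ψₙ ≥ 0` have summable
`π`-integrals, so they tend to zero `π`-almost everywhere. -/
lemma IsOptimizer.exists_potentials_tendsto {X Y : Type*}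
    [TopologicalSpace X] [PolishSpace X] [MeasurableSpace X] [BorelSpace X]
    [TopologicalSpace Y] [PolishSpace Y] [MeasurableSpace Y] [BorelSpace Y]
    {μ : Measure X} [IsProbabilityMeasure μ] {ν : Measure Y} [IsProbabilityMeasure ν]
    {c : X × Y → ℝ≥0∞} (hc : LowerSemicontinuous c) {π : Measure (X × Y)}
    (hopt : IsOptimizer μ ν c π) (hcost : transportCost c π < ⊤) :
    ∃ (φ : ℕ → X →ᵇ ℝ) (ψ : ℕ → Y →ᵇ ℝ),
      (∀ n x y, ENNReal.ofReal (φ n x + ψ n y) ≤ c (x, y)) ∧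
      ∀ᵐ z ∂π, Tendsto (fun n ↦ φ n z.1 + ψ n z.2) atTop (𝓝 (c z).toReal) := by
  choose φ ψ hle hlt using fun n : ℕ ↦
    hopt.exists_potentials_lt hc (ε := (1 / 2) ^ n) (by positivity)
  refine ⟨φ, ψ, hle, ?_⟩
  have hcm : Measurable c := hc.measurable
  have hctop : ∀ᵐ z ∂π, c z < ∞ := ae_lt_top hcm hcost.ne
  have hcint : Integrable (fun z ↦ (c z).toReal) π :=
    integrable_toReal_of_lintegral_ne_top hcm.aemeasurable hcost.ne
  have hcI : ∫ z, (c z).toReal ∂π = (transportCost c π).toReal :=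
    integral_toReal hcm.aemeasurable hctop
  let h : ℕ → X × Y → ℝ := fun n z ↦ (c z).toReal - (φ n z.1 + ψ n z.2)
  have hm : ∀ n, Measurable (h n) := fun n ↦ by
    have h1 := (φ n).continuous.measurable
    have h2 := (ψ n).continuous.measurable
    fun_prop
  have hnn : ∀ᵐ z ∂π, ∀ n, 0 ≤ h n z := by
    filter_upwards [hctop] with z hz n
    have := ENNReal.toReal_mono hz.ne (hle n z.1 z.2)
    rw [ENNReal.toReal_ofReal'] at this
    exact sub_nonneg.2 ((le_max_left _ _).trans this)
  have hI : ∀ n, ∫⁻ z, ENNReal.ofReal (h n z) ∂π ≤ ENNReal.ofReal ((1 / 2) ^ n) := fun n ↦ by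
    obtain ⟨hi, hi'⟩ := transportPlans.integral_add_eq hopt.1 (φ n) (ψ n)
    have hhi : Integrable (h n) π := hcint.sub hi
    rw [← ofReal_integral_eq_lintegral_ofReal hhi (hnn.mono fun z hz ↦ hz n)]
    refine ENNReal.ofReal_le_ofReal ?_
    have : ∫ z, h n z ∂π = _ := integral_sub hcint hi
    rw [this, hcI, hi']
    linarith [hlt n]
  have hsum : ∫⁻ z, ∑' n, ENNReal.ofReal (h n z) ∂π ≠ ∞ := by
    rw [lintegral_tsum fun n ↦ (hm n).ennreal_ofReal.aemeasurable]
    refine ne_top_of_le_ne_top ?_ (ENNReal.tsum_le_tsum hI)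
    rw [← ENNReal.ofReal_tsum_of_nonneg (fun n ↦ by positivity) summable_geometric_two]
    exact ENNReal.ofReal_ne_top
  filter_upwards [hnn, ae_lt_top (Measurable.tsum fun n ↦ (hm n).ennreal_ofReal) hsum]
    with z hz hz'
  have h1 := (ENNReal.tendsto_toReal ENNReal.zero_ne_top).comp
    (ENNReal.tendsto_atTop_zero_of_tsum_ne_top hz'.ne)
  have h2 : Tendsto (fun n ↦ h n z) atTop (𝓝 0) := by
    simpa [Function.comp_def, ENNReal.toReal_ofReal, hz] using h1
  simpa [h] using (tendsto_const_nhds (x := (c z).toReal)).sub h2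

/-! ### Passing to the limit in the potentials -/

lemma limsup_add_liminf_le_coe {a b : ℕ → ℝ} {c : ℝ≥0∞}
    (h : ∀ n, ENNReal.ofReal (a n + b n) ≤ c) :
    limsup (fun n ↦ (a n : EReal)) atTop + liminf (fun n ↦ (b n : EReal)) atTop ≤ (c : EReal) := by
  refine EReal.le_limsup_add.trans (limsup_le_of_le (h := Eventually.of_forall fun n ↦ ?_))
  calc (a n : EReal) + b n = ((a n + b n : ℝ) : EReal) := (EReal.coe_add _ _).symm
    _ ≤ ((max (a n + b n) 0 : ℝ) : EReal) := EReal.coe_le_coe (le_max_left _ _)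
    _ = (ENNReal.ofReal (a n + b n) : EReal) := (EReal.coe_ennreal_ofReal).symm
    _ ≤ c := EReal.coe_ennreal_le_coe_ennreal_iff.2 (h n)

/-- Limits of potentials whose sums converge to the cost `π`-almost everywhere: after a shift by
constants, the upper limit of the first potentials and the lower limit of the second ones are
admissible and add up to the cost. That the cost is finite almost everywhere for the product measure
is what keeps both limits below `+∞` at `π`-almost every point. -/
theorem exists_potentials_of_tendsto {X Y : Type*} [MeasurableSpace X] [MeasurableSpace Y]
    {μ : Measure X} [SFinite μ] {ν : Measure Y} [SFinite ν] {c : X × Y → ℝ≥0∞}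
    (hfin : ∀ᵐ z ∂(μ.prod ν), c z ≠ ⊤) {π : Measure (X × Y)} (hπ : π ∈ transportPlans μ ν)
    (hcπ : ∀ᵐ z ∂π, c z ≠ ⊤) {f : ℕ → X → ℝ} {g : ℕ → Y → ℝ}
    (hf : ∀ n, Measurable (f n)) (hg : ∀ n, Measurable (g n))
    (hle : ∀ n x y, ENNReal.ofReal (f n x + g n y) ≤ c (x, y))
    (hlim : ∀ᵐ z ∂π, Tendsto (fun n ↦ f n z.1 + g n z.2) atTop (𝓝 (c z).toReal)) :
    ∃ (φ : X → EReal) (ψ : Y → EReal),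
      Measurable φ ∧ Measurable ψ ∧ (∀ x, φ x ≠ ⊤) ∧ (∀ y, ψ y ≠ ⊤) ∧
      (∀ x y, φ x + ψ y ≤ (c (x, y) : EReal)) ∧
      ∀ᵐ z ∂π, φ z.1 + ψ z.2 = (c z : EReal) := by
  classical
  obtain ⟨hprob, hfst, hsnd⟩ := hπ
  have hX : ∀ᵐ z ∂π, ∀ᵐ y ∂ν, c (z.1, y) ≠ ⊤ :=
    ae_of_ae_map (p := fun x ↦ ∀ᵐ y ∂ν, c (x, y) ≠ ⊤) measurable_fst.aemeasurable
      (hfst ▸ Measure.ae_ae_of_ae_prod hfin)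
  have hY : ∀ᵐ z ∂π, ∀ᵐ x ∂μ, c (x, z.2) ≠ ⊤ :=
    ae_of_ae_map (p := fun y ↦ ∀ᵐ x ∂μ, c (x, y) ≠ ⊤) measurable_snd.aemeasurable
      (hsnd ▸ Measure.ae_ae_of_ae_prod
        (Measure.measurePreserving_swap.quasiMeasurePreserving.ae hfin))
  obtain ⟨⟨x₀, y₀⟩, hx₀, hy₀, hlim₀⟩ := (hX.and (hY.and hlim)).exists
  -- The sums are unchanged, and the normalized first potentials vanish at `x₀`.
  let a : X → ℕ → ℝ := fun x n ↦ f n x - f n x₀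
  let b : Y → ℕ → ℝ := fun y n ↦ g n y + f n x₀
  have hab : ∀ x y n, a x n + b y n = f n x + g n y := fun x y n ↦ by simp only [a, b]; ring
  let Φ : X → EReal := fun x ↦ limsup (fun n ↦ (a x n : EReal)) atTop
  let Ψ : Y → EReal := fun y ↦ liminf (fun n ↦ (b y n : EReal)) atTop
  have hΦm : Measurable Φ := .limsup fun n ↦ ((hf n).sub_const _).coe_real_ereal
  have hΨm : Measurable Ψ := .liminf fun n ↦ ((hg n).add_const _).coe_real_ereal
  have hΦΨ : ∀ x y, Φ x + Ψ y ≤ (c (x, y) : EReal) := fun x y ↦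
    limsup_add_liminf_le_coe fun n ↦ (hab x y n).symm ▸ hle n x y
  have hΦ₀ : Φ x₀ = 0 := by simp [Φ, a]
  have hΨ₀ : Ψ y₀ = ((c (x₀, y₀)).toReal : EReal) := by
    refine Tendsto.liminf_eq ((continuous_coe_real_ereal.tendsto _).comp ?_)
    simpa [b, add_comm] using hlim₀
  have hΨtop : ∀ y, c (x₀, y) ≠ ⊤ → Ψ y ≠ ⊤ := fun y hy h ↦ by
    have := hΦΨ x₀ y
    rw [hΦ₀, zero_add, h, top_le_iff] at this
    simp_all
  have hΦtop : ∀ x, c (x, y₀) ≠ ⊤ → Φ x ≠ ⊤ := fun x hx h ↦ by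
    have := hΦΨ x y₀
    rw [hΨ₀, h, EReal.top_add_coe, top_le_iff] at this
    simp_all
  -- Values `⊤` only occur on null sets; replacing them by `⊥` keeps the inequality valid.
  refine ⟨fun x ↦ if Φ x = ⊤ then ⊥ else Φ x, fun y ↦ if Ψ y = ⊤ then ⊥ else Ψ y,
    .ite (hΦm (measurableSet_singleton ⊤)) measurable_const hΦm,
    .ite (hΨm (measurableSet_singleton ⊤)) measurable_const hΨm,
    fun x ↦ ?_, fun y ↦ ?_, fun x y ↦ ?_, ?_⟩
  · dsimp only; split_ifs with h <;> simp [h]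
  · dsimp only; split_ifs with h <;> simp [h]
  · dsimp only; split_ifs with h h' <;> simp [hΦΨ]
  have hx : ∀ᵐ z ∂π, c (z.1, y₀) ≠ ⊤ :=
    ae_of_ae_map (p := fun x ↦ c (x, y₀) ≠ ⊤) measurable_fst.aemeasurable (hfst ▸ hy₀)
  have hy : ∀ᵐ z ∂π, c (x₀, z.2) ≠ ⊤ :=
    ae_of_ae_map (p := fun y ↦ c (x₀, y) ≠ ⊤) measurable_snd.aemeasurable (hsnd ▸ hx₀)
  filter_upwards [hx, hy, hcπ, hlim] with ⟨x, y⟩ hx hy hc hl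
  rw [if_neg (hΦtop x hx), if_neg (hΨtop y hy)]
  refine le_antisymm (hΦΨ x y) ?_
  have h1 : Tendsto (fun n ↦ (a x n : EReal) + (b y n : EReal)) atTop (𝓝 (c (x, y) : EReal)) := by
    rw [← EReal.coe_ennreal_toReal hc]
    simp only [← EReal.coe_add, hab]
    exact (continuous_coe_real_ereal.tendsto _).comp hl
  exact h1.liminf_eq.symm.trans_le
    (EReal.liminf_add_le (.inr (hΨtop y hy)) (.inl (hΦtop x hx)))

theorem mainTheorem4 {X Y : Type*}
    [TopologicalSpace X] [PolishSpace X] [MeasurableSpace X] [BorelSpace X]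
    [TopologicalSpace Y] [PolishSpace Y] [MeasurableSpace Y] [BorelSpace Y]
    (μ : Measure X) [IsProbabilityMeasure μ] (ν : Measure Y) [IsProbabilityMeasure ν]
    (c : X × Y → ℝ≥0∞) (hc : LowerSemicontinuous c)
    (hfin : ∀ᵐ z ∂(μ.prod ν), c z ≠ ⊤)
    (πhat : Measure (X × Y)) (hopt : IsOptimizer μ ν c πhat)
    (hcost : transportCost c πhat < ⊤) :
    (∃ (φ : X → EReal) (ψ : Y → EReal),
      Measurable φ ∧ Measurable ψ ∧ (∀ x, φ x ≠ ⊤) ∧ (∀ y, ψ y ≠ ⊤) ∧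
      (∀ x y, φ x + ψ y ≤ (c (x, y) : EReal)) ∧
      ∀ᵐ z ∂πhat, φ z.1 + ψ z.2 = (c z : EReal)) ∧
    IsStronglyMonotonePlan c πhat := by
  obtain ⟨f, g, hle, hlim⟩ := hopt.exists_potentials_tendsto hc hcost
  have hcm : Measurable c := hc.measurable
  have hcπ : ∀ᵐ z ∂πhat, c z ≠ ⊤ := (ae_lt_top hcm hcost.ne).mono fun _ h ↦ h.ne
  obtain ⟨φ, ψ, hφ, hψ, hφtop, hψtop, hφψ, hae⟩ :=
    exists_potentials_of_tendsto hfin hopt.1 hcπ (fun n ↦ (f n).continuous.measurable)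
      (fun n ↦ (g n).continuous.measurable) hle hlim
  have hΓ : MeasurableSet {z : X × Y | φ z.1 + ψ z.2 = (c z : EReal)} :=
    measurableSet_eq_fun ((hφ.comp measurable_fst).add (hψ.comp measurable_snd))
      hcm.coe_ereal_ennreal
  refine ⟨⟨φ, ψ, hφ, hψ, hφtop, hψtop, hφψ, hae⟩,
    {z | φ z.1 + ψ z.2 = (c z : EReal)}, ⟨hΓ, φ, ψ, hφ, hψ, hφtop, hψtop, hφψ, fun _ _ h ↦ h⟩, ?_⟩
  have := hopt.1.1
  exact (mem_ae_iff_prob_eq_one hΓ).1 hae
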